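/- Let $X$ be a set. A \emph{partial transformation} of $X$ is a map $\omega : D_\omega \to X$ with $\varnothing \subseteq D_\omega \subseteq X$. Let $\mathcal{M}$ be a set of partial transformations of $X$ that contains the identity $X\to X$ and is closed under composition (the domain of $\omega'\circ\omega$ being $\{x\in D_\omega : \omega(x)\in D_{\omega'}\}$). A \emph{preference} on $X$ is a complete and transitive binary relation $\succeq$, with asymmetric part $\succ$; it is \emph{$\mathcal{M}$-invariant} if for all $\omega\in\mathcal{M}$ and $x,y\in D_\omega$: $x\succeq y \iff \omega(x)\succeq\omega(y)$. An \emph{order pair} $\langle W,S\rangle$ consists of binary relations $S\subseteq W\subseteq X\times X$. The data are an order pair $\langle \succsim^R,\succ^R\rangle$ with $\succsim^R$ reflexive. A preference $\succeq$ \emph{rationalizes} the data if $\succsim^R\,\subseteq\,\succeq$ and $\succ^R\,\subseteq\,\succ$. Write $x\succsim^R_\intercal y$ if there is a finite chain $x=x_0\succsim^R x_1\succsim^R\cdots\succsim^R x_N=y$, and $x\succ^R_\intercal y$ if there is such a chain with at least one link in $\succ^R$. A \emph{broken cycle} consists of $N\ge 1$, $\omega_1,\dots,\omega_N\in\mathcal{M}$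 and $x_i,y_i\in D_{\omega_i}$ ($1\le i\le N$) such that $\omega_i(x_i)\succsim^R_\intercal\omega_{i+1}(y_{i+1})$ for all $i$, indices modulo $N$; it is \emph{strict} if $\omega_i(x_i)\succ^R_\intercal\omega_{i+1}(y_{i+1})$ for some $i$. A \emph{forbidden subrelation} of it is an order pair $\langle W,S\rangle$ with $W=\{(y_i,x_i):1\le i\le N\}$ and, if the broken cycle is not strict, $S\neq\varnothing$. A finite order pair $\langle \tilde W,\tilde S\rangle$ is a \emph{collapse} of two finite order pairs $\langle W_1,S_1\rangle$, $\langle W_2,S_2\rangle$ if for some $\{i,j\}=\{1,2\}$, some $\omega,\omega'\in\mathcal{M}$ and some $x,y\in D_\omega\cap D_{\omega'}$, with $p=(\omega(x),\omega(y))$ and $q=(\omega'(y),\omega'(x))$, we have $p\in W_i\setminus S_i$, $q\in W_j$, $\tilde W=(W_i\setminus\{p\})\cup(W_j\setminus\{q\})$ and $\tilde S=S_i\cup(S_j\setminus\{q\})$. Let $\mathcal{F}^0$ be the set of all forbidden subrelations of broken cycles of the data, let $\mathcal{F}^{n}$ be $\mathcal{F}^{n-1}$ together with all collapses of pairs in $\mathcal{F}^{n-1}$,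 and let $\mathcal{F}^*=\bigcup_{n\ge0}\mathcal{F}^n$. The data are \emph{strongly acyclic} if $\langle\varnothing,\varnothing\rangle\notin\mathcal{F}^*$. \textbf{Theorem.} The data $\langle \succsim^R,\succ^R\rangle$ are strongly acyclic if and only if they are rationalizable by an $\mathcal{M}$-invariant preference. -/

import Mathlib

namespace RevealedPref

variable {X : Type*}

/-- An order pair on `X`: a relation `weak` together with a sub-relation `strict`
(not assumed to be the asymmetric part of `weak`). -/
@[ext]
structure OrderPair (X : Type*) where
  weak : Set (X × X)
  strict : Set (X × X)
  strict_subset : strict ⊆ weak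

/-- The empty order pair. -/
def OrderPair.empty (X : Type*) : OrderPair X where
  weak := ∅
  strict := ∅
  strict_subset := subset_rfl

/-- The weak part of the transitive closure of an order pair: there is a finite chain
`x = x₀, x₁, …, x_N = y` of weak comparisons. The chain with `N = 0` is allowed, which makes
no difference when the weak relation is reflexive. -/
def OrderPair.TransWeak (D : OrderPair X) : X → X → Prop :=
  Relation.ReflTransGen fun x y => (x, y) ∈ D.weak

/-- The strict part of the transitive closure of an order pair: there is a finite chain of weak
comparisons from `x` to `y`, at least one link of which is a strict comparison. -/
def OrderPair.TransStrict (D : OrderPair X) (x y : X) : Prop :=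
  ∃ u v, D.TransWeak x u ∧ (u, v) ∈ D.strict ∧ D.TransWeak v y

/-- A preference relation: complete and transitive. -/
structure IsPreference (r : X → X → Prop) : Prop where
  complete : ∀ x y, r x y ∨ r y x
  trans : ∀ x y z, r x y → r y z → r x z

/-- The asymmetric (strict) component of a relation. -/
def StrictPart (r : X → X → Prop) (x y : X) : Prop := r x y ∧ ¬ r y x

/-- Invariance of a relation under every partial transformation in `M`. -/
def IsInvariant (M : Set (X →. X)) (r : X → X → Prop) : Prop :=
  ∀ ω ∈ M, ∀ (x y : X) (hx : x ∈ ω.Dom) (hy : y ∈ ω.Dom), r x y ↔ r (ω.fn x hx) (ω.fn y hy)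

/-- `r` rationalizes the data `D`: it contains the weak data, and its strict part contains the
strict data. -/
structure Rationalizes (r : X → X → Prop) (D : OrderPair X) : Prop where
  weak : ∀ x y, (x, y) ∈ D.weak → r x y
  strict : ∀ x y, (x, y) ∈ D.strict → StrictPart r x y

/-- The data `D` can be rationalized by an `M`-invariant preference relation. -/
def Rationalizable (M : Set (X →. X)) (D : OrderPair X) : Prop :=
  ∃ r : X → X → Prop, IsPreference r ∧ IsInvariant M r ∧ Rationalizes r D

/-- A broken cycle of length `N = n + 1 ≥ 1` in the data: partial transformations `ω i` in `M`
and alternatives `x i`, `y i` in the domain of `ω i` such that `ω i (x i)` is weakly above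
`ω (i + 1) (y (i + 1))` in the transitive closure of the data, indices being taken modulo `N`
(addition in `Fin (n + 1)` is cyclic). -/
structure BrokenCycle (M : Set (X →. X)) (D : OrderPair X) where
  n : ℕ
  ω : Fin (n + 1) → (X →. X)
  ω_mem : ∀ i, ω i ∈ M
  x : Fin (n + 1) → X
  y : Fin (n + 1) → X
  x_mem : ∀ i, x i ∈ (ω i).Dom
  y_mem : ∀ i, y i ∈ (ω i).Dom
  rel : ∀ i, D.TransWeak ((ω i).fn (x i) (x_mem i)) ((ω (i + 1)).fn (y (i + 1)) (y_mem (i + 1)))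

/-- A broken cycle is strict if one of its comparisons is strict in the transitive closure. -/
def BrokenCycle.IsStrict {M : Set (X →. X)} {D : OrderPair X} (c : BrokenCycle M D) : Prop :=
  ∃ i, D.TransStrict ((c.ω i).fn (c.x i) (c.x_mem i))
    ((c.ω (i + 1)).fn (c.y (i + 1)) (c.y_mem (i + 1)))

/-- `P` is a forbidden subrelation for the broken cycle `c`: its weak part consists of the pairs
`(y i, x i)`, and its strict part is nonempty unless the broken cycle is strict. -/
structure IsForbidden {M : Set (X →. X)} {D : OrderPair X} (c : BrokenCycle M D)
    (P : OrderPair X) : Prop where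
  weak_eq : P.weak = Set.range fun i => (c.y i, c.x i)
  strict_nonempty : ¬ c.IsStrict → P.strict.Nonempty

/-- `T` is obtained from `P` (in the role of the pair with index `i`) and `Q` (in the role of the
pair with index `j`) by deleting `(ω a, ω b) ∈ P.weak \ P.strict` and `(ω' b, ω' a) ∈ Q.weak`,
and taking unions. -/
def CollapseOf (M : Set (X →. X)) (P Q T : OrderPair X) : Prop :=
  ∃ ω ∈ M, ∃ ω' ∈ M, ∃ (a b : X) (ha : a ∈ ω.Dom) (hb : b ∈ ω.Dom)
    (ha' : a ∈ ω'.Dom) (hb' : b ∈ ω'.Dom),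
    (ω.fn a ha, ω.fn b hb) ∈ P.weak \ P.strict ∧
    (ω'.fn b hb', ω'.fn a ha') ∈ Q.weak ∧
    T.weak = (P.weak \ {(ω.fn a ha, ω.fn b hb)}) ∪ (Q.weak \ {(ω'.fn b hb', ω'.fn a ha')}) ∧
    T.strict = P.strict ∪ (Q.strict \ {(ω'.fn b hb', ω'.fn a ha')})

/-- `T` is a collapse of the two order pairs `P₁` and `P₂`, in either order. -/
def IsCollapse (M : Set (X →. X)) (P₁ P₂ T : OrderPair X) : Prop :=
  CollapseOf M P₁ P₂ T ∨ CollapseOf M P₂ P₁ T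

/-- The sets `F⁰ ⊆ F¹ ⊆ …`: `F⁰` consists of the forbidden subrelations of the broken cycles of the
data, and each further set adds the collapses of two members of the preceding one. All their
members are finite relations. -/
def forbiddenLevel (M : Set (X →. X)) (D : OrderPair X) : ℕ → Set (OrderPair X)
  | 0 => {P | ∃ c : BrokenCycle M D, IsForbidden c P}
  | n + 1 => {T | ∃ P₁ ∈ forbiddenLevel M D n, ∃ P₂ ∈ forbiddenLevel M D n, IsCollapse M P₁ P₂ T} ∪
      forbiddenLevel M D n

/-- The union `F*` of the sets `Fⁿ`. -/
def forbiddenClosure (M : Set (X →. X)) (D : OrderPair X) : Set (OrderPair X) :=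
  ⋃ n, forbiddenLevel M D n

/-- The data are strongly acyclic if the empty order pair does not belong to `F*`. -/
def StronglyAcyclic (M : Set (X →. X)) (D : OrderPair X) : Prop :=
  OrderPair.empty X ∉ forbiddenClosure M D

end RevealedPref

namespace RevealedPref

/-! Members of `forbiddenClosure` act as clauses: each lists comparisons that no invariant
rationalizing preference satisfies jointly, and a collapse is a resolution step. Soundness: a broken
cycle would close into a preference cycle with a strict link, and resolution preserves
impossibility; the empty pair holds vacuously, so it is never derived. Completeness: Zorn's lemma
gives a maximal pair of weak and strict comparisons containing no forbidden pair. If it left a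
comparison undecided, both ways of deciding it would be refuted, and collapsing the two refutations
would refute the pair itself (`mem_or_mem_of_maximal`). Broken cycles of length three, two and one
then give transitivity, invariance and agreement with the data. -/

/-- The relation `r` satisfies the comparisons listed in the order pair `P`. -/
def Extends {X : Type*} (r : X → X → Prop) (P : OrderPair X) : Prop :=
  (∀ p ∈ P.weak, r p.1 p.2) ∧ ∀ p ∈ P.strict, StrictPart r p.1 p.2

/-! ### Soundness: rationalizability excludes the empty pair. -/

section Soundness

variable {X : Type*} {M : Set (X →. X)} {D : OrderPair X} {r : X → X → Prop}

theorem IsPreference.refl (hr : IsPreference r) (x : X) : r x x :=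
  (hr.complete x x).elim id id

theorem IsPreference.of_cyclic (hr : IsPreference r) {n : ℕ} {f : Fin (n + 1) → X}
    (hf : ∀ i, r (f i) (f (i + 1))) (i j : Fin (n + 1)) : r (f i) (f j) := by
  have key : ∀ k : Fin (n + 1), r (f i) (f (i + k)) := by
    intro k
    induction k using Fin.induction with
    | zero => simpa using hr.refl (f i)
    | succ k ih =>
      have h := hr.trans _ _ _ ih (hf _)
      rwa [add_assoc, Fin.coeSucc_eq_succ] at h
  have h := key (j - i)
  rwa [add_sub_cancel] at h

theorem Rationalizes.of_transWeak (hr : IsPreference r) (hD : Rationalizes r D) {x y : X}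
    (h : D.TransWeak x y) : r x y := by
  induction h with
  | refl => exact hr.refl x
  | tail _ h ih => exact hr.trans _ _ _ ih (hD.weak _ _ h)

theorem Rationalizes.of_transStrict (hr : IsPreference r) (hD : Rationalizes r D) {x y : X}
    (h : D.TransStrict x y) : ¬ r y x := by
  obtain ⟨u, v, hxu, huv, hvy⟩ := h
  intro hyx
  exact (hD.strict _ _ huv).2 (hr.trans _ _ _ (hD.of_transWeak hr hvy)
    (hr.trans _ _ _ hyx (hD.of_transWeak hr hxu)))

theorem not_extends_of_isForbidden (hr : IsPreference r) (hM : IsInvariant M r)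
    (hD : Rationalizes r D) {c : BrokenCycle M D} {P : OrderPair X} (hP : IsForbidden c P) :
    ¬ Extends r P := by
  rintro ⟨hw, hs⟩
  have hyx : ∀ i, r ((c.ω i).fn (c.y i) (c.y_mem i)) ((c.ω i).fn (c.x i) (c.x_mem i)) :=
    fun i => (hM _ (c.ω_mem i) _ _ _ _).1 (hw (c.y i, c.x i) (hP.weak_eq ▸ ⟨i, rfl⟩))
  have hxy := fun i => hD.of_transWeak hr (c.rel i)
  -- The images of the `x i` descend weakly around the cycle, so they are all indifferent.
  have hall := hr.of_cyclic (f := fun i => (c.ω i).fn (c.x i) (c.x_mem i))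
    fun i => hr.trans _ _ _ (hxy i) (hyx (i + 1))
  by_cases hc : c.IsStrict
  · obtain ⟨i, hi⟩ := hc
    exact hD.of_transStrict hr hi (hr.trans _ _ _ (hyx _) (hall _ _))
  · obtain ⟨p, hp⟩ := hP.strict_nonempty hc
    have hpw := P.strict_subset hp
    rw [hP.weak_eq] at hpw
    obtain ⟨i, rfl⟩ := hpw
    refine (hs _ hp).2 ((hM _ (c.ω_mem i) _ _ (c.x_mem i) (c.y_mem i)).2 ?_)
    -- The comparison that arrives at the image of `y i` is the one indexed by `i - 1`.
    have h := hxy (i - 1)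
    simp only [sub_add_cancel] at h
    exact hr.trans _ _ _ (hall i (i - 1)) h

/-- Resolution on `r a b`: if it holds, invariance restores the deleted weak pair of `P`; if not,
completeness makes `b` strictly better than `a`, which restores the deleted pair of `Q` even if it
was strict there. -/
theorem not_extends_of_collapseOf (hr : IsPreference r) (hM : IsInvariant M r)
    {P Q T : OrderPair X} (hP : ¬ Extends r P) (hQ : ¬ Extends r Q) (hT : CollapseOf M P Q T) :
    ¬ Extends r T := by
  obtain ⟨ω, hω, ω', hω', a, b, ha, hb, ha', hb', hp, -, hTw, hTs⟩ := hT
  rintro ⟨hw, hs⟩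
  rw [hTw] at hw
  rw [hTs] at hs
  by_cases hab : r a b
  · refine hP ⟨fun p hpP => ?_, fun p hpP => hs p (.inl hpP)⟩
    by_cases h : p = (ω.fn a ha, ω.fn b hb)
    · subst h
      exact (hM ω hω a b ha hb).1 hab
    · exact hw p (.inl ⟨hpP, h⟩)
  · have hba : StrictPart r (ω'.fn b hb') (ω'.fn a ha') :=
      ⟨(hM ω' hω' b a hb' ha').1 ((hr.complete a b).resolve_left hab),
        fun h => hab ((hM ω' hω' a b ha' hb').2 h)⟩
    refine hQ ⟨fun p hpQ => ?_, fun p hpQ => ?_⟩ <;>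
      by_cases h : p = (ω'.fn b hb', ω'.fn a ha')
    · subst h
      exact hba.1
    · exact hw p (.inr ⟨hpQ, h⟩)
    · subst h
      exact hba
    · exact hs p (.inr ⟨hpQ, h⟩)

theorem not_extends_of_mem_forbiddenLevel (hr : IsPreference r) (hM : IsInvariant M r)
    (hD : Rationalizes r D) (n : ℕ) : ∀ P ∈ forbiddenLevel M D n, ¬ Extends r P := by
  induction n with
  | zero =>
    rintro P ⟨c, hc⟩
    exact not_extends_of_isForbidden hr hM hD hc
  | succ n ih =>
    rintro T (⟨P, hP, Q, hQ, hT | hT⟩ | hT)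
    · exact not_extends_of_collapseOf hr hM (ih P hP) (ih Q hQ) hT
    · exact not_extends_of_collapseOf hr hM (ih Q hQ) (ih P hP) hT
    · exact ih T hT

theorem Rationalizable.stronglyAcyclic (h : Rationalizable M D) : StronglyAcyclic M D := by
  obtain ⟨r, hr, hM, hD⟩ := h
  intro hmem
  obtain ⟨n, hn⟩ := Set.mem_iUnion.1 hmem
  exact not_extends_of_mem_forbiddenLevel hr hM hD n _ hn ⟨fun _ h => h.elim, fun _ h => h.elim⟩

end Soundness

/-! ### Completeness: a maximal consistent pair is a preference. -/

section Completeness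

variable {X : Type*} {M : Set (X →. X)} {D : OrderPair X}

theorem finite_weak_of_mem_forbiddenLevel (n : ℕ) :
    ∀ P ∈ forbiddenLevel M D n, P.weak.Finite := by
  induction n with
  | zero =>
    rintro P ⟨c, hc⟩
    rw [hc.weak_eq]
    exact Set.finite_range _
  | succ n ih =>
    have key : ∀ P ∈ forbiddenLevel M D n, ∀ Q ∈ forbiddenLevel M D n, ∀ T,
        CollapseOf M P Q T → T.weak.Finite := by
      rintro P hP Q hQ T ⟨ω, -, ω', -, a, b, ha, hb, ha', hb', -, -, hw, -⟩
      rw [hw]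
      exact ((ih P hP).subset Set.sdiff_subset).union ((ih Q hQ).subset Set.sdiff_subset)
    rintro T (⟨P, hP, Q, hQ, hT | hT⟩ | hT)
    · exact key P hP Q hQ T hT
    · exact key Q hQ P hP T hT
    · exact ih T hT

theorem finite_weak_of_mem_forbiddenClosure {P : OrderPair X} (hP : P ∈ forbiddenClosure M D) :
    P.weak.Finite := by
  obtain ⟨n, hn⟩ := Set.mem_iUnion.1 hP
  exact finite_weak_of_mem_forbiddenLevel n P hn

theorem forbiddenLevel_mono : Monotone (forbiddenLevel M D) :=
  monotone_nat_of_le_succ fun _ => Set.subset_union_right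

theorem CollapseOf.mem_forbiddenClosure {P Q T : OrderPair X} (hT : CollapseOf M P Q T)
    (hP : P ∈ forbiddenClosure M D) (hQ : Q ∈ forbiddenClosure M D) :
    T ∈ forbiddenClosure M D := by
  obtain ⟨m, hm⟩ := Set.mem_iUnion.1 hP
  obtain ⟨n, hn⟩ := Set.mem_iUnion.1 hQ
  exact Set.mem_iUnion.2 ⟨max m n + 1, .inl ⟨P, forbiddenLevel_mono (le_max_left m n) hm,
    Q, forbiddenLevel_mono (le_max_right m n) hn, .inl hT⟩⟩

theorem IsForbidden.mem_forbiddenClosure {c : BrokenCycle M D} {P : OrderPair X}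
    (hP : IsForbidden c P) : P ∈ forbiddenClosure M D :=
  Set.mem_iUnion.2 ⟨0, c, hP⟩

/-- A pair of sets of comparisons (weak and strict) is consistent if the strict comparisons are
among the weak ones and no member of the forbidden closure is contained in it. -/
def Consistent (M : Set (X →. X)) (D : OrderPair X) (A : Set (X × X) × Set (X × X)) : Prop :=
  A.2 ⊆ A.1 ∧ ∀ P ∈ forbiddenClosure M D, P.weak ⊆ A.1 → ¬ P.strict ⊆ A.2

theorem StronglyAcyclic.consistent_empty (h : StronglyAcyclic M D) : Consistent M D (∅, ∅) := by
  refine ⟨subset_rfl, fun P hP hw hs => h ?_⟩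
  have : P = OrderPair.empty X :=
    OrderPair.ext (Set.subset_empty_iff.1 hw) (Set.subset_empty_iff.1 hs)
  rwa [← this]

/-- Compactness: forbidden pairs are finite, so one inside the union of a chain already lies in a
single member. -/
theorem consistent_of_isChain {c : Set (Set (X × X) × Set (X × X))}
    (hc : ∀ A ∈ c, Consistent M D A) (hchain : IsChain (· ≤ ·) c) (hne : c.Nonempty) :
    Consistent M D (⋃ A ∈ c, A.1, ⋃ A ∈ c, A.2) := by
  refine ⟨Set.iUnion₂_mono fun A hA => (hc A hA).1, fun P hP hw hs => ?_⟩
  have hfin := finite_weak_of_mem_forbiddenClosure hP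
  have hdir : DirectedOn (· ≤ ·) c := hchain.directedOn
  have cover : ∀ (π : Set (X × X) × Set (X × X) → Set (X × X)), Monotone π →
      ∀ s : Set (X × X), s.Finite → s ⊆ ⋃ A ∈ c, π A → ∃ A ∈ c, s ⊆ π A := by
    intro π hπ s hs
    induction s, hs using Set.Finite.induction_on with
    | empty => exact fun _ => hne.imp fun A hA => ⟨hA, Set.empty_subset _⟩
    | insert _ _ ih =>
      intro hsub
      obtain ⟨A, hA, hsA⟩ := ih ((Set.subset_insert _ _).trans hsub)
      obtain ⟨B, hB, haB⟩ := Set.mem_iUnion₂.1 (hsub (Set.mem_insert _ _))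
      obtain ⟨C, hC, hAC, hBC⟩ := hdir A hA B hB
      exact ⟨C, hC, Set.insert_subset (hπ hBC haB) (hsA.trans (hπ hAC))⟩
  obtain ⟨A, hA, hwA⟩ := cover Prod.fst monotone_fst P.weak hfin hw
  obtain ⟨B, hB, hsB⟩ := cover Prod.snd monotone_snd P.strict (hfin.subset P.strict_subset) hs
  obtain ⟨C, hC, hAC, hBC⟩ := hdir A hA B hB
  exact (hc C hC).2 P hP (hwA.trans hAC.1) (hsB.trans hBC.2)

theorem StronglyAcyclic.exists_maximal_consistent (h : StronglyAcyclic M D) :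
    ∃ A, Maximal (Consistent M D) A := by
  obtain ⟨A, -, hA⟩ := zorn_le_nonempty₀ {A | Consistent M D A}
    (fun c hc hchain A hA => ⟨_, consistent_of_isChain (fun B hB => hc hB) hchain ⟨A, hA⟩,
      fun B hB => ⟨Set.subset_biUnion_of_mem (u := Prod.fst) hB,
        Set.subset_biUnion_of_mem (u := Prod.snd) hB⟩⟩) _ h.consistent_empty
  exact ⟨A, hA⟩

/-- A maximal consistent pair decides every comparison. -/
theorem mem_or_mem_of_maximal (hid : PFun.id X ∈ M) {A : Set (X × X) × Set (X × X)}
    (hA : Maximal (Consistent M D) A) (a b : X) : (a, b) ∈ A.1 ∨ (b, a) ∈ A.2 := by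
  by_contra! hcon
  obtain ⟨hab, hba⟩ := hcon
  obtain ⟨hsub, hforb⟩ := hA.prop
  -- By maximality, adding `(a, b)` weakly is refuted by some `P`, and adding `(b, a)` strictly by
  -- some `Q`.
  obtain ⟨P, hP, hPw, hPs⟩ : ∃ P ∈ forbiddenClosure M D,
      P.weak ⊆ insert (a, b) A.1 ∧ P.strict ⊆ A.2 := by
    by_contra! h
    exact hab ((hA.le_of_ge (y := (insert (a, b) A.1, A.2))
      ⟨hsub.trans (Set.subset_insert _ _), h⟩ ⟨Set.subset_insert _ _, subset_rfl⟩).1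
      (Set.mem_insert _ _))
  obtain ⟨Q, hQ, hQw, hQs⟩ : ∃ Q ∈ forbiddenClosure M D,
      Q.weak ⊆ insert (b, a) A.1 ∧ Q.strict ⊆ insert (b, a) A.2 := by
    by_contra! h
    exact hba ((hA.le_of_ge (y := (insert (b, a) A.1, insert (b, a) A.2))
      ⟨Set.insert_subset_insert hsub, h⟩ ⟨Set.subset_insert _ _, Set.subset_insert _ _⟩).2
      (Set.mem_insert _ _))
  have hpP : (a, b) ∈ P.weak := by
    by_contra h
    exact hforb P hP ((Set.subset_insert_iff_of_notMem h).1 hPw) hPs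
  -- Only the weak part was enlarged by `(a, b)`, so the pair is not strict in `P`, as a collapse
  -- requires.
  have hpS : (a, b) ∉ P.strict := fun h => hab (hsub (hPs h))
  have hqQ : (b, a) ∈ Q.weak := by
    by_contra h
    exact hforb Q hQ ((Set.subset_insert_iff_of_notMem h).1 hQw)
      ((Set.subset_insert_iff_of_notMem fun h' => h (Q.strict_subset h')).1 hQs)
  let T : OrderPair X :=
    { weak := (P.weak \ {(a, b)}) ∪ (Q.weak \ {(b, a)})
      strict := P.strict ∪ (Q.strict \ {(b, a)})
      strict_subset := Set.union_subset_union
        (fun p hp => ⟨P.strict_subset hp, fun h => hpS (h ▸ hp)⟩)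
        (Set.sdiff_subset_sdiff_left Q.strict_subset) }
  have hT : CollapseOf M P Q T :=
    ⟨_, hid, _, hid, a, b, trivial, trivial, trivial, trivial, ⟨hpP, hpS⟩, hqQ, rfl, rfl⟩
  refine hforb T (hT.mem_forbiddenClosure hP hQ) (Set.union_subset ?_ ?_) (Set.union_subset hPs ?_)
  · exact Set.sdiff_singleton_subset_iff.2 hPw
  · exact Set.sdiff_singleton_subset_iff.2 hQw
  · exact Set.sdiff_singleton_subset_iff.2 hQs

/-- A broken cycle of length two, one of whose pairs is required to be strict. -/
theorem mem_forbiddenClosure_of_two {ω ω' : X →. X} (hω : ω ∈ M) (hω' : ω' ∈ M) {x y x' y' : X}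
    (hx : x ∈ ω.Dom) (hy : y ∈ ω.Dom) (hx' : x' ∈ ω'.Dom) (hy' : y' ∈ ω'.Dom)
    (h : ω.fn x hx = ω'.fn y' hy') (h' : ω'.fn x' hx' = ω.fn y hy) :
    (⟨{(y, x), (y', x')}, {(y', x')}, by simp⟩ : OrderPair X) ∈ forbiddenClosure M D := by
  let c : BrokenCycle M D :=
    { n := 1
      ω := ![ω, ω']
      ω_mem := Fin.forall_fin_two.2 ⟨hω, hω'⟩
      x := ![x, x']
      y := ![y, y']
      x_mem := Fin.forall_fin_two.2 ⟨hx, hx'⟩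
      y_mem := Fin.forall_fin_two.2 ⟨hy, hy'⟩
      rel := Fin.forall_fin_two.2 ⟨h ▸ .refl, h' ▸ .refl⟩ }
  refine IsForbidden.mem_forbiddenClosure (c := c) ⟨?_, fun _ => ⟨_, rfl⟩⟩
  ext p
  simp [c, Fin.exists_fin_two, eq_comm]

theorem StronglyAcyclic.rationalizable (hid : PFun.id X ∈ M) (h : StronglyAcyclic M D) :
    Rationalizable M D := by
  obtain ⟨A, hA⟩ := h.exists_maximal_consistent
  have hdec := mem_or_mem_of_maximal hid hA
  obtain ⟨hsub, hforb⟩ := hA.prop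
  have hstrict : ∀ {a b}, (b, a) ∉ A.1 → (a, b) ∈ A.2 := fun {a b} => (hdec b a).resolve_left
  refine ⟨fun x y => (x, y) ∈ A.1, ⟨fun x y => (hdec x y).imp_right fun h => hsub h, ?_⟩, ?_, ?_, ?_⟩
  · intro x y z hxy hyz
    by_contra hxz
    -- The sequences are shifted so that `x i = y (i + 1)`; every link is then reflexive.
    let c : BrokenCycle M D :=
      { n := 2
        ω := fun _ => PFun.id X
        ω_mem := fun _ => hid
        x := ![y, z, x]
        y := ![x, y, z]
        x_mem := fun _ => trivial
        y_mem := fun _ => trivial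
        rel := by
          intro i
          fin_cases i <;> exact .refl }
    have hzx := hstrict hxz
    refine hforb ⟨{(x, y), (y, z), (z, x)}, {(z, x)}, by simp⟩
      (IsForbidden.mem_forbiddenClosure (c := c) ⟨?_, fun _ => ⟨_, rfl⟩⟩) ?_ ?_
    · ext p
      simp [c, Fin.exists_fin_succ, eq_comm]
    · simp [Set.insert_subset_iff, hxy, hyz, hsub hzx]
    · simpa using hzx
  · intro ω hω x y hx hy
    constructor
    · intro hxy
      by_contra hcon
      have hs := hstrict hcon
      refine hforb _ (mem_forbiddenClosure_of_two hω hid hy hx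
        (x' := ω.fn x hx) (y' := ω.fn y hy) trivial trivial rfl rfl) ?_ ?_
      · exact Set.insert_subset hxy (Set.singleton_subset_iff.2 (hsub hs))
      · simpa using hs
    · intro hxy
      by_contra hcon
      have hs := hstrict hcon
      refine hforb _ (mem_forbiddenClosure_of_two hid hω
        (x := ω.fn y hy) (y := ω.fn x hx) trivial trivial hx hy rfl rfl) ?_ ?_
      · exact Set.insert_subset hxy (Set.singleton_subset_iff.2 (hsub hs))
      · simpa using hs
  all_goals
    intro x y hxy
    let c (hw : (x, y) ∈ D.weak) : BrokenCycle M D :=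
      { n := 0
        ω := fun _ => PFun.id X
        ω_mem := fun _ => hid
        x := fun _ => x
        y := fun _ => y
        x_mem := fun _ => trivial
        y_mem := fun _ => trivial
        rel := fun _ => .single hw }
  · by_contra hcon
    have hs := hstrict hcon
    refine hforb ⟨{(y, x)}, {(y, x)}, subset_rfl⟩
      (IsForbidden.mem_forbiddenClosure (c := c hxy) ⟨by simp [c], fun _ => ⟨_, rfl⟩⟩) ?_ ?_
    · simpa using hsub hs
    · simpa using hs
  · have hyx : (y, x) ∉ A.1 := by
      intro hyx
      -- A strict cycle permits an empty strict part, so even the weak comparison `(y, x)` is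
      -- excluded.
      have hc : (c (D.strict_subset hxy)).IsStrict := ⟨0, x, y, .refl, hxy, .refl⟩
      exact hforb ⟨{(y, x)}, ∅, Set.empty_subset _⟩
        (IsForbidden.mem_forbiddenClosure (c := c (D.strict_subset hxy))
          ⟨by simp [c], fun hn => (hn hc).elim⟩)
        (by simpa using hyx) (Set.empty_subset _)
    exact ⟨hsub (hstrict hyx), hyx⟩

end Completeness

end RevealedPref

theorem theorem3 {X : Type*} (M : Set (X →. X))
    (hid : PFun.id X ∈ M)
    (hcomp : ∀ ω ∈ M, ∀ ω' ∈ M, PFun.comp ω' ω ∈ M)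
    (D : RevealedPref.OrderPair X)
    (hrefl : ∀ x, (x, x) ∈ D.weak) :
    RevealedPref.StronglyAcyclic M D ↔ RevealedPref.Rationalizable M D :=
  ⟨fun h => h.rationalizable hid, fun h => h.stronglyAcyclic⟩
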